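/- Let $n \ge 1$, let $\ell_\infty^n$ be $\mathbb{R}^n$ with the norm $\|x\|_\infty = \max_{1 \le i \le n} |x_i|$, and let $X$ be an $(n-1)$-dimensional linear subspace of $\ell_\infty^n$ with the restricted norm. Let $Y$ be an $(n-1)$-dimensional real normed space such that $d(X, Y) \le 2$, where $$d(X, Y) = \inf \{ \|T\| \cdot \|T^{-1}\| : T : X \to Y \text{ a linear isomorphism} \}$$ is the multiplicative Banach--Mazur distance. Then $e(Y) \ge \lceil n/2 \rceil$. Here the equilateral dimension $e(Y)$ is the maximal cardinality of an equilateral set in $Y$, where a set $S \subseteq Y$ is called equilateral if there is $p > 0$ such that $\|x - y\| = p$ for all $x, y \in S$ with $x \ne y$. -/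

import Mathlib

open scoped ENNReal

/-- A set `S` in a real normed space is equilateral if there is `p > 0` such that any two distinct
points of `S` are at distance `p`. -/
def IsEquilateral {X : Type*} [NormedAddCommGroup X] (S : Set X) : Prop :=
  ∃ p : ℝ, 0 < p ∧ ∀ x ∈ S, ∀ y ∈ S, x ≠ y → ‖x - y‖ = p

/-- The equilateral dimension `e(X)`: the largest cardinality of an equilateral set in `X`, as a
supremum in `ℕ∞`. -/
noncomputable def equilateralDim (X : Type*) [NormedAddCommGroup X] : ℕ∞ :=
  ⨆ S : {S : Set X // IsEquilateral S}, S.1.encard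

/-- The (multiplicative) Banach-Mazur distance: the infimum of `‖T‖ * ‖T⁻¹‖` over all linear
isomorphisms `T : X → Y`, in `[0, ∞]` (it is `∞` when there is no isomorphism). -/
noncomputable def banachMazurDist (X Y : Type*) [NormedAddCommGroup X] [NormedSpace ℝ X]
    [NormedAddCommGroup Y] [NormedSpace ℝ Y] : ℝ≥0∞ :=
  ⨅ T : X ≃L[ℝ] Y, ENNReal.ofReal (‖(T : X →L[ℝ] Y)‖ * ‖(T.symm : Y →L[ℝ] X)‖)

section EquilateralDimension

open Metric MeasureTheory Set Filter Topology

/-! Put k = ⌊(n-1)/2⌋, so that k + 1 = ⌈n/2⌉. The hyperplane X contains an isometric copy of ℓ_∞^k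
(`exists_linearIsometry_hyperplane`). By compactness the Banach-Mazur infimum is attained, so
composing gives a linear L : ℓ_∞^k → Y with ‖v‖/2 ≤ ‖L v‖ ≤ ‖v‖.

In ℓ_∞^k there are k + 1 points p_i(ε) whose distances 1 + ε_ij, with ε_ij ∈ [0, 1], can be
prescribed independently. Their images are 1-equilateral exactly when ε_ij = 1 + ε_ij - ‖L(p_i -
p_j)‖. The bounds on L make the right side a self-map of the cube, and Brouwer's theorem gives a
fixed point (`le_equilateralDim_of_linearMap`).

Brouwer's theorem is proved by a volume argument: a C¹ retraction onto the sphere would force the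
ball to have volume zero. -/

theorem LipschitzOnWith.indicator_closedBall {E F : Type*} [NormedAddCommGroup E]
    [NormedSpace ℝ E] [NormedAddCommGroup F] {K : NNReal} {g : E → F}
    (hg : LipschitzOnWith K g (closedBall 0 1)) (h0 : ∀ x, ‖x‖ = 1 → g x = 0) :
    LipschitzWith K ((closedBall (0 : E) 1).indicator g) := by
  have key : ∀ x ∈ closedBall (0 : E) 1, ∀ y ∉ closedBall (0 : E) 1,
      dist (g x) 0 ≤ K * dist x y := by
    intro x hx y hy
    rw [mem_closedBall_zero_iff] at hx hy
    obtain ⟨z, hz, hz1⟩ : ∃ z ∈ segment ℝ x y, ‖z‖ = 1 :=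
      (convex_segment x y).isPreconnected.intermediate_value (left_mem_segment ℝ x y)
        (right_mem_segment ℝ x y) continuous_norm.continuousOn ⟨hx, (not_le.1 hy).le⟩
    have h1 := hg.dist_le_mul x (by simpa using hx) z (by simp [hz1])
    rw [h0 z hz1] at h1
    refine h1.trans (mul_le_mul_of_nonneg_left ?_ K.2)
    have := dist_add_dist_of_mem_segment hz
    linarith [dist_nonneg (x := z) (y := y)]
  refine LipschitzWith.of_dist_le_mul fun x y => ?_
  by_cases hx : x ∈ closedBall (0 : E) 1 <;> by_cases hy : y ∈ closedBall (0 : E) 1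
  · simpa [indicator_of_mem hx, indicator_of_mem hy] using hg.dist_le_mul x hx y hy
  · simpa only [indicator_of_mem hx, indicator_of_notMem hy] using key x hx y hy
  · rw [indicator_of_notMem hx, indicator_of_mem hy, dist_comm, dist_comm x]
    exact key y hy x hx
  · simp only [indicator_of_notMem hx, indicator_of_notMem hy, dist_self]
    positivity

/-- By the Neumann series 1 + sA stays invertible for s ∈ [0, 1], so its determinant keeps the sign
it has at s = 0. -/
theorem ContinuousLinearMap.det_one_add_pos {E : Type*} [NormedAddCommGroup E] [NormedSpace ℝ E]
    [FiniteDimensional ℝ E] {A : E →L[ℝ] E} (hA : ‖A‖ < 1) : 0 < (1 + A).det := by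
  have : CompleteSpace E := FiniteDimensional.complete ℝ E
  have hcont : Continuous fun s : ℝ => (1 + s • A).det :=
    ContinuousLinearMap.continuous_det.comp (by fun_prop)
  have hne : ∀ s ∈ Icc (0 : ℝ) 1, (1 + s • A).det ≠ 0 := by
    intro s hs h0
    have hn : ‖-(s • A)‖ < 1 := by
      rw [norm_neg, norm_smul, Real.norm_of_nonneg hs.1]
      nlinarith [hs.2, norm_nonneg A]
    have hu : IsUnit (1 + s • A) := by
      simpa using (Units.oneSub (-(s • A)) hn).isUnit
    have := hu.map (ContinuousLinearMap.toLinearMapRingHom : (E →L[ℝ] E) →+* (E →ₗ[ℝ] E))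
    have h2 := LinearMap.isUnit_iff_isUnit_det _ |>.1 this
    exact h2.ne_zero h0
  by_contra! hneg
  obtain ⟨s, hs, h⟩ := isPreconnected_Icc.intermediate_value (right_mem_Icc.2 zero_le_one)
    (left_mem_Icc.2 zero_le_one) hcont.continuousOn
    (show (0 : ℝ) ∈ Icc _ _ from ⟨by simpa using hneg, by simp [ContinuousLinearMap.det]⟩)
  exact hne s hs h

/-- The determinant of `1 + t A` is a polynomial in `t` of degree at most the dimension. -/
theorem LinearMap.exists_polynomial_det_one_add_smul {E : Type*} [AddCommGroup E] [Module ℝ E]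
    [FiniteDimensional ℝ E] (A : E →ₗ[ℝ] E) :
    ∃ p : Polynomial ℝ, p.natDegree ≤ Module.finrank ℝ E ∧
      ∀ t : ℝ, p.eval t = LinearMap.det (1 + t • A) := by
  classical
  let b := Module.finBasis ℝ E
  let M := LinearMap.toMatrix b b A
  refine ⟨Matrix.det ((Polynomial.X : Polynomial ℝ) • M.map Polynomial.C +
    (1 : Matrix _ _ ℝ).map Polynomial.C), ?_, fun t => ?_⟩
  · simpa using Polynomial.natDegree_det_X_add_C_le M 1
  · rw [← LinearMap.det_toMatrix b, ← Polynomial.coe_evalRingHom, RingHom.map_det]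
    congr 1
    ext i j
    rcases eq_or_ne i j with rfl | h
    · simp [M, LinearMap.toMatrix_apply]
      ring
    · simp [M, LinearMap.toMatrix_apply, h]
      ring

/-- There are weights that compute the value at `1` of any polynomial of degree at most `d` from
its values at `d + 1` points of `(0, δ)`. -/
theorem Polynomial.exists_interpolation_weights (d : ℕ) {δ : ℝ} (hδ : 0 < δ) :
    ∃ t c : Fin (d + 1) → ℝ, (∀ i, t i ∈ Ioo 0 δ) ∧
      ∀ p : Polynomial ℝ, p.natDegree ≤ d → p.eval 1 = ∑ i, c i * p.eval (t i) := by
  classical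
  let t : Fin (d + 1) → ℝ := fun i => δ * ((i + 1) / (d + 2))
  have ht : Function.Injective t := by
    intro i j h
    have h2 : ((d : ℝ) + 2) ≠ 0 := by positivity
    simp only [t] at h
    field_simp at h
    exact Fin.ext (by exact_mod_cast add_right_cancel h)
  refine ⟨t, fun i => (Lagrange.basis Finset.univ t i).eval 1, fun i => ⟨by positivity, ?_⟩, ?_⟩
  · refine mul_lt_of_lt_one_right hδ ((div_lt_one (by positivity)).2 ?_)
    have : (i : ℝ) < d + 1 := by exact_mod_cast i.2
    linarith
  · intro p hp
    have h := Lagrange.eq_interpolate (s := Finset.univ) (v := t) (f := p) ht.injOn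
      (lt_of_le_of_lt p.degree_le_natDegree (by
        rw [Finset.card_univ, Fintype.card_fin]
        exact_mod_cast Nat.lt_succ_of_le hp))
    conv_lhs => rw [h]
    simp [Lagrange.interpolate_apply, Polynomial.eval_finsetSum, mul_comm]

/-! ### No C¹ retraction of the ball onto the sphere -/

section NoRetraction

variable {E : Type*} [NormedAddCommGroup E] [InnerProductSpace ℝ E] [FiniteDimensional ℝ E]

/-- A small perturbation of the identity that vanishes on the unit sphere preserves the volume of
the unit ball. -/
theorem integral_det_one_add_smul_fderiv [MeasurableSpace E] [BorelSpace E] {g : E → E}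
    {K : NNReal} {t : ℝ}
    (ht : t ∈ Icc 0 1) (htK : t * K < 1) (hg : ∀ x ∈ closedBall (0 : E) 1, DifferentiableAt ℝ g x)
    (hK : ∀ x ∈ closedBall (0 : E) 1, ‖fderiv ℝ g x‖₊ ≤ K)
    (h0 : ∀ x, ‖x‖ = 1 → g x = 0) (h1 : ∀ x ∈ closedBall (0 : E) 1, ‖x + g x‖ ≤ 1) :
    ∫ x in closedBall (0 : E) 1, (1 + t • fderiv ℝ g x).det =
      volume.real (closedBall (0 : E) 1) := by
  have hlip : LipschitzOnWith K g (closedBall 0 1) :=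
    (convex_closedBall 0 1).lipschitzOnWith_of_nnnorm_fderiv_le hg hK
  have hlip' := hlip.indicator_closedBall h0
  set G := (closedBall (0 : E) 1).indicator g with hG
  let f : E → E := fun x => x + t • G x
  -- A perturbation of the identity with Lipschitz constant below 1 is a bijection of E. Since f is
  -- the identity off the ball, it maps the ball onto itself.
  have hf : ApproximatesLinearOn f (ContinuousLinearEquiv.refl ℝ E : E →L[ℝ] E) univ
      (t.toNNReal * K) := by
    rw [ApproximatesLinearOn.approximatesLinearOn_iff_lipschitzOnWith]
    refine LipschitzWith.lipschitzOnWith (LipschitzWith.of_dist_le_mul fun x y => ?_)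
    have := hlip'.dist_le_mul x y
    simp only [f, dist_eq_norm] at this ⊢
    simp only [Pi.sub_apply, ContinuousLinearEquiv.coe_refl, ContinuousLinearMap.coe_id', id,
      add_sub_cancel_left, ← smul_sub, norm_smul, Real.norm_of_nonneg ht.1]
    rw [NNReal.coe_mul, Real.coe_toNNReal t ht.1, mul_assoc]
    exact mul_le_mul_of_nonneg_left this ht.1
  have hc : Subsingleton E ∨ (t.toNNReal * K : NNReal) <
      ‖((ContinuousLinearEquiv.refl ℝ E).symm : E →L[ℝ] E)‖₊⁻¹ := by
    rcases subsingleton_or_nontrivial E with h | h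
    · exact Or.inl h
    · right
      have : ‖((ContinuousLinearEquiv.refl ℝ E).symm : E →L[ℝ] E)‖₊ = 1 :=
        ContinuousLinearMap.nnnorm_id
      rw [this, inv_one, ← NNReal.coe_lt_coe]
      rwa [NNReal.coe_mul, Real.coe_toNNReal t ht.1, NNReal.coe_one]
  have hinj : Function.Injective f := (injOn_univ.1 (hf.injOn hc))
  have hsurj : Function.Surjective f := hf.surjective hc
  have himage : f '' closedBall 0 1 = closedBall 0 1 := by
    apply Subset.antisymm
    · rintro _ ⟨x, hx, rfl⟩
      have h2 := h1 x hx
      have e : f x = (1 - t) • x + t • (x + g x) := by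
        simp only [f, hG, indicator_of_mem hx]
        module
      rw [mem_closedBall_zero_iff] at hx ⊢
      rw [e]
      refine (norm_add_le _ _).trans ?_
      rw [norm_smul, norm_smul, Real.norm_of_nonneg ht.1, Real.norm_of_nonneg (by linarith [ht.2])]
      nlinarith [ht.1, ht.2]
    · intro y hy
      obtain ⟨x, rfl⟩ := hsurj y
      by_cases hx : x ∈ closedBall (0 : E) 1
      · exact ⟨x, hx, rfl⟩
      · have : f x = x := by simp only [f, hG, indicator_of_notMem hx, smul_zero, add_zero]
        rw [this] at hy
        exact absurd hy hx
  have hderiv : ∀ x ∈ closedBall (0 : E) 1,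
      HasFDerivWithinAt f (1 + t • fderiv ℝ g x) (closedBall 0 1) x := by
    intro x hx
    have : HasFDerivAt (fun x => x + t • g x) (1 + t • fderiv ℝ g x) x :=
      (hasFDerivAt_id x).add ((hg x hx).hasFDerivAt.const_smul t)
    refine this.hasFDerivWithinAt.congr (fun y hy => ?_) ?_
    · simp only [f, hG, indicator_of_mem hy]
    · simp only [f, hG, indicator_of_mem hx]
  have hvol := integral_image_eq_integral_abs_det_fderiv_smul volume measurableSet_closedBall
    hderiv hinj.injOn (fun _ => (1 : ℝ))
  rw [himage] at hvol
  rw [setIntegral_const, smul_eq_mul, mul_one] at hvol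
  rw [hvol]
  refine setIntegral_congr_fun measurableSet_closedBall fun x hx => ?_
  have hpos : 0 < (1 + t • fderiv ℝ g x).det := by
    apply ContinuousLinearMap.det_one_add_pos
    rw [norm_smul, Real.norm_of_nonneg ht.1]
    exact lt_of_le_of_lt (mul_le_mul_of_nonneg_left (hK x hx) ht.1) htK
  simp only [smul_eq_mul, mul_one, abs_of_pos hpos]

/-- With g = r - id, the Jacobian of id + t g is polynomial in t and integrates to the volume of the
ball for small t > 0. Interpolating to t = 1 gives the same integral for r, whose Jacobian vanishes
because its image lies in the sphere. -/
theorem not_exists_contDiff_retraction_sphere {r : E → E}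
    (hr : ∀ x ∈ closedBall (0 : E) 1, ContDiffAt ℝ 1 r x) (hid : ∀ x, ‖x‖ = 1 → r x = x)
    (hs : ∀ x ∈ closedBall (0 : E) 1, ‖r x‖ = 1) : False := by
  borelize E
  have : ProperSpace E := FiniteDimensional.proper ℝ E
  let g : E → E := fun x => r x - x
  have hgC : ∀ x ∈ closedBall (0 : E) 1, ContDiffAt ℝ 1 g x :=
    fun x hx => (hr x hx).sub contDiffAt_id
  have hcont : ContinuousOn (fderiv ℝ g) (closedBall 0 1) := fun x hx =>
    ((hgC x hx).continuousAt_fderiv (by simp)).continuousWithinAt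
  obtain ⟨C, hC⟩ := (isCompact_closedBall (0 : E) 1).exists_bound_of_continuousOn hcont
  obtain ⟨t, c, ht, hp⟩ := Polynomial.exists_interpolation_weights (Module.finrank ℝ E)
    (δ := (1 + |C|)⁻¹) (by positivity)
  have hle : ∀ i, ∫ x in closedBall (0 : E) 1, (1 + t i • fderiv ℝ g x).det =
      volume.real (closedBall (0 : E) 1) := by
    intro i
    obtain ⟨ht0, ht1⟩ := ht i
    have hlt : t i * (1 + |C|) < 1 := by
      rwa [lt_inv_comm₀ ht0 (by positivity), lt_inv_comm₀ (by positivity) ht0,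
        ← one_div, lt_div_iff₀ (by positivity)] at ht1
    refine integral_det_one_add_smul_fderiv (K := Real.nnabs C) ⟨ht0.le, ?_⟩ ?_
      (fun x hx => (hgC x hx).differentiableAt (by simp)) (fun x hx => ?_) ?_ ?_
    · nlinarith [abs_nonneg C]
    · rw [Real.coe_nnabs]
      nlinarith [abs_nonneg C]
    · rw [← NNReal.coe_le_coe, Real.coe_nnabs]
      exact (hC x hx).trans (le_abs_self C)
    · intro x hx
      simp [g, hid x hx]
    · intro x hx
      simp [g, hs x hx]
  have hdet : ∀ x ∈ closedBall (0 : E) 1,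
      ∑ i, c i * (1 + t i • fderiv ℝ g x).det = 0 := by
    intro x hx
    obtain ⟨p, hpd, hpe⟩ := (fderiv ℝ g x : E →ₗ[ℝ] E).exists_polynomial_det_one_add_smul
    have h1 := hp p hpd
    simp only [hpe] at h1
    refine h1.symm.trans ?_
    rw [one_smul]
    have hrd : DifferentiableAt ℝ r x := (hr x hx).differentiableAt (by simp)
    have hfd : fderiv ℝ g x = fderiv ℝ r x - 1 := by
      have := (hrd.hasFDerivAt.sub (hasFDerivAt_id x)).fderiv
      exact this
    rw [hfd]
    have e : (1 + ((fderiv ℝ r x - 1 : E →L[ℝ] E) : E →ₗ[ℝ] E)) = (fderiv ℝ r x : E →ₗ[ℝ] E) := by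
      ext v
      simp
    rw [e]
    by_contra hne
    -- Differentiating ‖r‖² = 1 makes the range of the derivative orthogonal to r x, hence not all
    -- of E. Derivatives within the ball are unique, which covers boundary points.
    have hn : ∀ v, inner ℝ (r x) (fderiv ℝ r x v) = 0 := by
      intro v
      have h2 := hrd.hasFDerivAt.norm_sq.hasFDerivWithinAt (s := closedBall (0 : E) 1)
      have h3 : HasFDerivWithinAt (fun y => ‖r y‖ ^ 2) (0 : E →L[ℝ] ℝ) (closedBall (0 : E) 1) x :=
        (hasFDerivWithinAt_const (1 : ℝ) x _).congr (fun y hy => by simp [hs y hy])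
          (by simp [hs x hx])
      have hu : UniqueDiffWithinAt ℝ (closedBall (0 : E) 1) x :=
        uniqueDiffOn_convex (convex_closedBall 0 1)
          ⟨0, ball_subset_interior_closedBall (mem_ball_self one_pos)⟩ x hx
      simpa using DFunLike.congr_fun (hu.eq h2 h3) v
    obtain ⟨v, hv⟩ := (LinearMap.equivOfDetNeZero _ hne).surjective (r x)
    have hv' : fderiv ℝ r x v = r x := hv
    have := hn v
    rw [hv', real_inner_self_eq_norm_sq, hs x hx] at this
    norm_num at this
  have hint : ∫ x in closedBall (0 : E) 1, ∑ i, c i * (1 + t i • fderiv ℝ g x).det =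
      ∑ i, c i * volume.real (closedBall (0 : E) 1) := by
    rw [integral_finsetSum]
    · simp only [integral_const_mul, hle]
    · intro i _
      have : IntegrableOn (fun x => (1 + t i • fderiv ℝ g x).det) (closedBall (0 : E) 1) := by
        refine ContinuousOn.integrableOn_compact (isCompact_closedBall (0 : E) 1) ?_
        exact ContinuousLinearMap.continuous_det.comp_continuousOn
          (continuousOn_const.add (hcont.const_smul (t i)))
      exact Integrable.const_mul this _
  rw [setIntegral_congr_fun measurableSet_closedBall hdet] at hint
  have hsum : ∑ i, c i = 1 := by
    have := hp 1 (by simp)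
    simpa using this.symm
  rw [← Finset.sum_mul, hsum] at hint
  have hpos : 0 < volume.real (closedBall (0 : E) 1) :=
    ENNReal.toReal_pos (measure_closedBall_pos _ _ one_pos).ne' measure_closedBall_lt_top.ne
  simp at hint
  linarith

end NoRetraction

/-! ### Brouwer's fixed point theorem -/

section Brouwer

variable {E : Type*} [NormedAddCommGroup E] [InnerProductSpace ℝ E] [FiniteDimensional ℝ E]

/-- Without a fixed point, pushing x along the ray from f x through x until it meets the sphere
would be a C¹ retraction. -/
theorem exists_fixedPoint_of_contDiff {f : E → E} (hf : ContDiff ℝ 1 f) (hb : ∀ x, ‖f x‖ ≤ 1) :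
    ∃ x, f x = x := by
  by_contra! hne
  let u : E → E := fun x => x - f x
  have hu : ContDiff ℝ 1 u := contDiff_id.sub hf
  have hu0 : ∀ x, u x ≠ 0 := fun x h => hne x (sub_eq_zero.1 h).symm
  -- A quarter of the discriminant of ‖x + l • u x‖² = 1, a quadratic in l; the `l` below is its
  -- larger root, which is 0 on the sphere.
  let D : E → ℝ := fun x => inner ℝ x (u x) ^ 2 + ‖u x‖ ^ 2 * (1 - ‖x‖ ^ 2)
  have hDC : ContDiff ℝ 1 D :=
    ((contDiff_id.inner ℝ hu).pow 2).add ((hu.norm_sq ℝ).mul (contDiff_const.sub (contDiff_norm_sq ℝ)))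
  have hin : ∀ x, ‖x‖ = 1 → 0 < inner ℝ x (u x) := by
    intro x hx
    have h1 : inner ℝ x (f x) ≤ 1 := by
      have := real_inner_le_norm x (f x)
      rw [hx, one_mul] at this
      exact this.trans (hb x)
    rw [inner_sub_right, real_inner_self_eq_norm_sq, hx]
    rcases h1.lt_or_eq with h | h
    · linarith
    · have h2 : ‖u x‖ ^ 2 ≤ 0 := by
        rw [norm_sub_sq_real, hx, h]
        have := hb x
        nlinarith [norm_nonneg (f x)]
      exact absurd (norm_eq_zero.1 (pow_eq_zero_iff two_ne_zero |>.1 (le_antisymm h2 (by positivity))))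
        (hu0 x)
  have hD : ∀ x ∈ closedBall (0 : E) 1, 0 < D x := by
    intro x hx
    rw [mem_closedBall_zero_iff] at hx
    have hupos : 0 < ‖u x‖ := norm_pos_iff.2 (hu0 x)
    rcases hx.lt_or_eq with h | h
    · have : 0 < 1 - ‖x‖ ^ 2 := by nlinarith [norm_nonneg x]
      positivity
    · have := hin x h
      simp only [D, h]
      positivity
  let l : E → ℝ := fun x => (-inner ℝ x (u x) + √(D x)) / ‖u x‖ ^ 2
  refine not_exists_contDiff_retraction_sphere (r := fun x => x + l x • u x) ?_ ?_ ?_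
  · intro x hx
    have hl : ContDiffAt ℝ 1 l x :=
      ((contDiff_id.inner ℝ hu).neg.contDiffAt.add (hDC.contDiffAt.sqrt (hD x hx).ne')).div
        (hu.norm_sq ℝ).contDiffAt (by simpa using hu0 x)
    exact contDiffAt_id.add (hl.smul hu.contDiffAt)
  · intro x hx
    have : l x = 0 := by
      simp only [l, D, hx]
      rw [one_pow, sub_self, mul_zero, add_zero, Real.sqrt_sq (hin x hx).le]
      simp
    simp [this]
  · intro x hx
    have hupos : 0 < ‖u x‖ ^ 2 := by
      have := norm_pos_iff.2 (hu0 x)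
      positivity
    have hs := Real.sq_sqrt (hD x hx).le
    have hl : l x * ‖u x‖ ^ 2 = -inner ℝ x (u x) + √(D x) := div_mul_cancel₀ _ hupos.ne'
    have hD' : D x = inner ℝ x (u x) ^ 2 + ‖u x‖ ^ 2 * (1 - ‖x‖ ^ 2) := rfl
    rw [hD'] at hs
    have key : ‖u x‖ ^ 2 * (‖x + l x • u x‖ ^ 2 - 1) = 0 := by
      rw [norm_add_sq_real, inner_smul_right, norm_smul, mul_pow, Real.norm_eq_abs, sq_abs]
      have : √(D x) = l x * ‖u x‖ ^ 2 + inner ℝ x (u x) := by linarith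
      rw [hD'] at this
      rw [this] at hs
      linear_combination hs
    rcases mul_eq_zero.1 key with h | h
    · exact absurd h hupos.ne'
    · exact (pow_eq_one_iff_of_nonneg (norm_nonneg _) two_ne_zero).1 (by linarith)

/-- **Brouwer's fixed point theorem** for continuous self-maps of the unit ball. -/
theorem exists_fixedPoint_of_norm_le_one {f : E → E} (hf : Continuous f) (hb : ∀ x, ‖f x‖ ≤ 1) :
    ∃ x, f x = x := by
  have : ProperSpace E := FiniteDimensional.proper ℝ E
  by_contra! hne
  obtain ⟨x₀, -, hx₀⟩ := (isCompact_closedBall (0 : E) 1).exists_isMinOn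
    ⟨0, mem_closedBall_self zero_le_one⟩ (f := fun x => dist (f x) x) (by fun_prop)
  -- A partition of unity gives a C¹ map into the ball, closer to f than the least displacement of f
  -- there; a fixed point of it contradicts that minimality.
  obtain ⟨g, hg⟩ := exists_contMDiffMap_forall_mem_convex_of_local_const (n := 1)
    (modelWithCornersSelf ℝ E)
    (t := fun x => ball (f x) (dist (f x₀) x₀) ∩ closedBall (0 : E) 1)
    (fun x => (convex_ball _ _).inter (convex_closedBall _ _)) (fun x => ⟨f x, by
      filter_upwards [hf.continuousAt (ball_mem_nhds (f x) (dist_pos.2 (hne x₀)))] with y hy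
      exact ⟨by rwa [mem_ball, dist_comm], by simpa using hb x⟩⟩)
  obtain ⟨x, hx⟩ := exists_fixedPoint_of_contDiff (f := g) g.contMDiff.contDiff
    fun x => by simpa using (hg x).2
  have h1 := (hg x).1
  have h2 := (hg x).2
  rw [hx] at h1 h2
  rw [mem_ball, dist_comm] at h1
  exact absurd (hx₀ h2) (not_le.2 h1)

end Brouwer

/-- **Brouwer's fixed point theorem** for the cube. -/
theorem exists_fixedPoint_Icc {ι : Type*} [Fintype ι] {F : (ι → ℝ) → (ι → ℝ)} (hF : Continuous F)
    (hb : ∀ x ∈ Icc (0 : ι → ℝ) 1, F x ∈ Icc (0 : ι → ℝ) 1) : ∃ x ∈ Icc (0 : ι → ℝ) 1, F x = x := by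
  let e := EuclideanSpace.equiv ι ℝ
  let cl : (ι → ℝ) → (ι → ℝ) := fun x i => max 0 (min (x i) 1)
  have hcl : ∀ x, cl x ∈ Icc (0 : ι → ℝ) 1 := fun x =>
    ⟨fun i => le_max_left _ _, fun i => max_le zero_le_one (min_le_right _ _)⟩
  have hcl' : ∀ x ∈ Icc (0 : ι → ℝ) 1, cl x = x := fun x hx => by
    ext i
    simp only [cl]
    rw [min_eq_left (show x i ≤ 1 from hx.2 i), max_eq_right (show 0 ≤ x i from hx.1 i)]
  obtain ⟨C, hC⟩ := (isCompact_Icc (a := (0 : ι → ℝ)) (b := 1)).exists_bound_of_continuousOn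
    (f := e.symm) (by fun_prop)
  have hR : 0 < 1 + |C| := by positivity
  -- Clamping with `cl` extends F from the cube to the whole space; the factor 1 + |C| shrinks the
  -- cube into the Euclidean unit ball.
  obtain ⟨x, hx⟩ := exists_fixedPoint_of_norm_le_one
    (f := fun x => (1 + |C|)⁻¹ • e.symm (F (cl (e ((1 + |C|) • x))))) (by fun_prop) (fun x => by
      rw [norm_smul, norm_inv, Real.norm_of_nonneg hR.le, inv_mul_le_iff₀ hR, mul_one]
      linarith [hC _ (hb _ (hcl (e ((1 + |C|) • x)))), le_abs_self C])
  have h2 : F (cl (e ((1 + |C|) • x))) = e ((1 + |C|) • x) := by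
    conv_rhs => rw [← hx]
    rw [smul_inv_smul₀ hR.ne', e.apply_symm_apply]
  have h3 : e ((1 + |C|) • x) ∈ Icc (0 : ι → ℝ) 1 := h2 ▸ hb _ (hcl _)
  refine ⟨_, h3, ?_⟩
  rwa [hcl' _ h3] at h2

/-! ### Copies of ℓ_∞^k in hyperplanes -/

/-- Of two disjoint k-element index sets, take the one of smaller weight: its complement contains
the other. -/
theorem exists_embedding_sum_abs_le {k n : ℕ} (h : 2 * k ≤ n) (a : Fin n → ℝ) :
    ∃ s : Fin k ↪ Fin n, ∑ j, |a (s j)| ≤ ∑ i ∈ (Finset.univ.map s)ᶜ, |a i| := by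
  let s₁ : Fin k ↪ Fin n := ⟨fun j => ⟨j, by omega⟩, fun i j h => by simpa [Fin.ext_iff] using h⟩
  let s₂ : Fin k ↪ Fin n := ⟨fun j => ⟨k + j, by omega⟩, fun i j h => by simpa [Fin.ext_iff] using h⟩
  have hd : ∀ i j, s₁ i ≠ s₂ j := fun i j h => by
    have h' : (i : ℕ) = k + j := congrArg Fin.val h
    omega
  have key : ∀ s t : Fin k ↪ Fin n, (∀ i j, s i ≠ t j) →
      ∑ j, |a (t j)| ≤ ∑ i ∈ (Finset.univ.map s)ᶜ, |a i| := by
    intro s t hst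
    rw [← Finset.sum_map Finset.univ t fun i => |a i|]
    refine Finset.sum_le_sum_of_subset_of_nonneg (fun i hi => ?_) fun _ _ _ => abs_nonneg _
    simp only [Finset.mem_map, Finset.mem_univ, true_and, Finset.mem_compl, not_exists] at hi ⊢
    obtain ⟨j, rfl⟩ := hi
    exact fun i => hst i j
  rcases le_total (∑ j, |a (s₁ j)|) (∑ j, |a (s₂ j)|) with h | h
  · exact ⟨s₁, h.trans (key _ _ hd)⟩
  · exact ⟨s₂, h.trans (key _ _ fun i j => (hd j i).symm)⟩

/-- A hyperplane in `ℓ_∞^n` contains an isometric copy of `ℓ_∞^k` whenever `2 * k ≤ n`. -/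
theorem exists_linearIsometry_hyperplane {k n : ℕ} (h : 2 * k ≤ n) (X : Submodule ℝ (Fin n → ℝ))
    (hX : Module.finrank ℝ X + 1 = n) : ∃ L : (Fin k → ℝ) →ₗ[ℝ] X, ∀ v, ‖L v‖ = ‖v‖ := by
  classical
  have hlt : X < ⊤ := lt_top_iff_ne_top.2 fun h => by
    rw [h, finrank_top, Module.finrank_fin_fun] at hX
    omega
  obtain ⟨f, hf0, hf⟩ := X.exists_le_ker_of_lt_top hlt
  have hker : X = LinearMap.ker f := by
    refine Submodule.eq_of_le_of_finrank_eq hf ?_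
    have := Module.Dual.finrank_ker_add_one_of_ne_zero (f := f) hf0
    rw [Module.finrank_fin_fun] at this
    omega
  let a : Fin n → ℝ := fun i => f (Pi.single i 1)
  have hfa : ∀ x, f x = ∑ i, a i * x i := fun x => by
    rw [LinearMap.pi_apply_eq_sum_univ f x]
    refine Finset.sum_congr rfl fun i _ => ?_
    simp only [a, smul_eq_mul, mul_comm]
    congr 2
    ext j
    simp [Pi.single_apply, eq_comm]
  obtain ⟨s, hs⟩ := exists_embedding_sum_abs_le h a
  set A := ∑ i ∈ (Finset.univ.map s)ᶜ, |a i| with hA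
  have hApos : 0 < A := by
    refine (Finset.sum_nonneg fun _ _ => abs_nonneg _).lt_of_ne' fun h0 => hf0 ?_
    have h1 : ∀ i, a i = 0 := by
      intro i
      by_cases hi : i ∈ (Finset.univ.map s)ᶜ
      · exact abs_eq_zero.1 ((Finset.sum_eq_zero_iff_of_nonneg fun _ _ => abs_nonneg _).1 h0 i hi)
      · obtain ⟨j, rfl⟩ : ∃ j, s j = i := by simpa using hi
        have h2 : ∑ j, |a (s j)| = 0 :=
          le_antisymm (hs.trans h0.le) (Finset.sum_nonneg fun _ _ => abs_nonneg _)
        exact abs_eq_zero.1 ((Finset.sum_eq_zero_iff_of_nonneg fun _ _ => abs_nonneg _).1 h2 j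
          (Finset.mem_univ _))
    refine LinearMap.ext fun x => ?_
    simp [hfa, h1]
  -- Coordinates in s carry v; the others are -sign(a i) · c v, with c v chosen so that f vanishes.
  -- The choice of s gives |c v| ≤ ‖v‖, so the norm does not grow.
  let c : (Fin k → ℝ) →ₗ[ℝ] ℝ :=
    A⁻¹ • Fintype.linearCombination ℝ (fun j => a (s j))
  have hc : ∀ v, c v = A⁻¹ * ∑ j, a (s j) * v j := fun v => by
    simp [c, Fintype.linearCombination_apply, mul_comm]
  have hcn : ∀ v, |c v| ≤ ‖v‖ := by
    intro v
    rw [hc, abs_mul, abs_of_pos (inv_pos.2 hApos), inv_mul_le_iff₀ hApos]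
    calc |∑ j, a (s j) * v j| ≤ ∑ j, |a (s j)| * ‖v‖ := by
          refine (Finset.abs_sum_le_sum_abs _ _).trans (Finset.sum_le_sum fun j _ => ?_)
          rw [abs_mul]
          exact mul_le_mul_of_nonneg_left (norm_le_pi_norm v j) (abs_nonneg _)
      _ ≤ A * ‖v‖ := by
          rw [← Finset.sum_mul]
          exact mul_le_mul_of_nonneg_right hs (norm_nonneg v)
  let w : Fin n → ℝ := fun i => -(SignType.sign (a i) : ℝ)
  have hw : ∀ i, |w i| ≤ 1 := fun i => by
    simp only [w, abs_neg]
    rcases SignType.sign (a i) with _ | _ | _ <;> simp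
  let M : (Fin k → ℝ) →ₗ[ℝ] (Fin n → ℝ) :=
    { toFun := fun v => Function.extend s v (c v • w)
      map_add' := fun u v => by rw [map_add, add_smul, Function.extend_add]
      map_smul' := fun r v => by
        rw [map_smul, RingHom.id_apply, smul_assoc, Function.extend_smul] }
  have hMs : ∀ v j, M v (s j) = v j := fun v j => s.injective.extend_apply _ _ _
  have hMt : ∀ v i, i ∈ (Finset.univ.map s)ᶜ → M v i = c v * w i := fun v i hi =>
    Function.extend_apply' _ _ _ (by simpa using hi)
  have hMX : ∀ v, M v ∈ X := by
    intro v
    rw [hker, LinearMap.mem_ker, hfa, ← Finset.sum_add_sum_compl (Finset.univ.map s),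
      Finset.sum_map]
    have h1 : ∑ i ∈ (Finset.univ.map s)ᶜ, a i * M v i = -(c v * A) := by
      rw [hA, Finset.mul_sum, ← Finset.sum_neg_distrib]
      refine Finset.sum_congr rfl fun i hi => ?_
      rw [hMt v i hi, ← self_mul_sign (a i)]
      simp only [w]
      ring
    simp only [hMs]
    rw [h1, hc]
    field_simp
    ring
  refine ⟨M.codRestrict X hMX, fun v => ?_⟩
  change ‖M v‖ = ‖v‖
  apply le_antisymm
  · refine (pi_norm_le_iff_of_nonneg (norm_nonneg v)).2 fun i => ?_
    by_cases hi : i ∈ (Finset.univ.map s)ᶜ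
    · rw [hMt v i hi, Real.norm_eq_abs, abs_mul]
      exact (mul_le_of_le_one_right (abs_nonneg _) (hw i)).trans (hcn v)
    · obtain ⟨j, rfl⟩ : ∃ j, s j = i := by simpa using hi
      rw [hMs]
      exact norm_le_pi_norm v j
  · refine (pi_norm_le_iff_of_nonneg (norm_nonneg _)).2 fun j => ?_
    rw [← hMs v j]
    exact norm_le_pi_norm (M v) (s j)

/-! ### Equilateral sets from a fixed point -/

/-- The points of `ℓ_∞^k` whose pairwise distances are `1 + ε (i, j)`. -/
def perturbedPoint {k : ℕ} (ε : Fin (k + 1) × Fin k → ℝ) (i : Fin (k + 1)) (j : Fin k) : ℝ :=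
  if j.castSucc = i then -1 else if j.castSucc < i then ε (i, j) else 0

theorem perturbedPoint_mem_Icc {k : ℕ} {ε : Fin (k + 1) × Fin k → ℝ}
    (hε : ε ∈ Icc (0 : Fin (k + 1) × Fin k → ℝ) 1) {i : Fin (k + 1)} {j : Fin k}
    (h : j.castSucc ≠ i) : perturbedPoint ε i j ∈ Icc (0 : ℝ) 1 := by
  rw [perturbedPoint, if_neg h]
  split_ifs
  · exact ⟨hε.1 (i, j), hε.2 (i, j)⟩
  · simp

/-- Coordinate j compares ε (i, j) with -1. Elsewhere the gap is at most 1: the only other -1, at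
coordinate i, faces a 0. -/
theorem norm_perturbedPoint_sub {k : ℕ} {ε : Fin (k + 1) × Fin k → ℝ}
    (hε : ε ∈ Icc (0 : Fin (k + 1) × Fin k → ℝ) 1) {i : Fin (k + 1)} {j : Fin k}
    (hj : j.castSucc < i) :
    ‖perturbedPoint ε i - perturbedPoint ε j.castSucc‖ = 1 + ε (i, j) := by
  have h0 : 0 ≤ ε (i, j) := hε.1 (i, j)
  have hij : (perturbedPoint ε i - perturbedPoint ε j.castSucc) j = 1 + ε (i, j) := by
    simp [perturbedPoint, hj, hj.ne]
    ring
  apply le_antisymm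
  · refine (pi_norm_le_iff_of_nonneg (by positivity)).2 fun l => ?_
    rcases eq_or_ne l j with rfl | hlj
    · rw [hij, Real.norm_of_nonneg (by positivity)]
    have hl := perturbedPoint_mem_Icc hε (i := j.castSucc) (j := l) (by simpa using hlj)
    rw [Pi.sub_apply, Real.norm_eq_abs, abs_le]
    by_cases hli : l.castSucc = i
    · have h1 : perturbedPoint ε i l = -1 := if_pos hli
      have h2 : perturbedPoint ε j.castSucc l = 0 := by
        rw [perturbedPoint, if_neg (by simpa using hlj), if_neg (by rw [hli]; exact hj.asymm)]
      rw [h1, h2]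
      constructor <;> linarith
    · have hl' := perturbedPoint_mem_Icc hε hli
      constructor <;> linarith [hl.1, hl.2, hl'.1, hl'.2]
  · have := norm_le_pi_norm (perturbedPoint ε i - perturbedPoint ε j.castSucc) j
    rw [hij] at this
    exact (le_abs_self _).trans this

theorem le_equilateralDim_of_linearMap {Y : Type*} [NormedAddCommGroup Y] [NormedSpace ℝ Y] {k : ℕ}
    (L : (Fin k → ℝ) →ₗ[ℝ] Y) (hL : ∀ v, ‖L v‖ ≤ ‖v‖) (hL' : ∀ v, ‖v‖ ≤ 2 * ‖L v‖) :
    ((k + 1 : ℕ) : ℕ∞) ≤ equilateralDim Y := by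
  have hLc : Continuous L := L.continuous_of_finiteDimensional
  have hpc : ∀ i, Continuous fun ε : Fin (k + 1) × Fin k → ℝ => perturbedPoint ε i := fun i => by
    refine continuous_pi fun j => ?_
    unfold perturbedPoint
    split_ifs <;> fun_prop
  -- Each pair is indexed once, by j < i; the unused coordinates are set to 0 so that F acts on a
  -- full cube.
  let F : (Fin (k + 1) × Fin k → ℝ) → (Fin (k + 1) × Fin k → ℝ) := fun ε q =>
    if q.2.castSucc < q.1 then
      1 + ε q - ‖L (perturbedPoint ε q.1 - perturbedPoint ε q.2.castSucc)‖ else 0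
  have hF : Continuous F := by
    refine continuous_pi fun q => ?_
    simp only [F]
    split_ifs
    · exact (continuous_const.add (continuous_apply q)).sub
        (hLc.comp ((hpc _).sub (hpc _))).norm
    · exact continuous_const
  obtain ⟨ε, hε, hfix⟩ := exists_fixedPoint_Icc hF fun ε hε => by
    have : ∀ q, F ε q ∈ Icc (0 : ℝ) 1 := by
      rintro ⟨i, j⟩
      simp only [F]
      split_ifs with h
      · have h1 := hL (perturbedPoint ε i - perturbedPoint ε j.castSucc)
        have h2 := hL' (perturbedPoint ε i - perturbedPoint ε j.castSucc)
        rw [norm_perturbedPoint_sub hε h] at h1 h2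
        have h3 : ε (i, j) ≤ 1 := hε.2 (i, j)
        constructor <;> linarith
      · simp
    exact ⟨fun q => (this q).1, fun q => (this q).2⟩
  let y : Fin (k + 1) → Y := fun i => L (perturbedPoint ε i)
  have hlt : ∀ i i', i' < i → ‖y i - y i'‖ = 1 := by
    intro i i' h
    obtain ⟨j, rfl⟩ := Fin.exists_castSucc_eq.2 (h.trans_le (Fin.le_last i)).ne
    have h1 := congrFun hfix (i, j)
    simp only [F, if_pos h] at h1
    rw [← map_sub]
    linarith
  have hne : ∀ i i', i ≠ i' → ‖y i - y i'‖ = 1 := by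
    intro i i' h
    rcases h.lt_or_gt with h | h
    · rw [norm_sub_rev]
      exact hlt _ _ h
    · exact hlt _ _ h
  have hinj : Function.Injective y := by
    intro i i' h
    by_contra h'
    simpa [h] using hne i i' h'
  have heq : IsEquilateral (range y) := by
    refine ⟨1, one_pos, ?_⟩
    rintro _ ⟨i, rfl⟩ _ ⟨i', rfl⟩ h
    exact hne i i' fun h' => h (by rw [h'])
  refine le_trans ?_ (le_iSup (fun S : {S : Set Y // IsEquilateral S} => S.1.encard) ⟨_, heq⟩)
  change _ ≤ (range y).encard
  rw [← image_univ, hinj.encard_image, encard_univ]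
  simp

/-! ### Attaining the Banach-Mazur distance -/

/-- The infimum in the Banach-Mazur distance between finite-dimensional spaces is attained. -/
theorem exists_linearMap_of_banachMazurDist_le {X Y : Type*} [NormedAddCommGroup X]
    [NormedSpace ℝ X] [FiniteDimensional ℝ X] [NormedAddCommGroup Y] [NormedSpace ℝ Y]
    [FiniteDimensional ℝ Y] {d : ℝ} (hd : 0 ≤ d) (h : banachMazurDist X Y ≤ ENNReal.ofReal d) :
    ∃ T : X →L[ℝ] Y, (∀ x, ‖T x‖ ≤ ‖x‖) ∧ ∀ x, ‖x‖ ≤ d * ‖T x‖ := by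
  have hex : ∀ N : ℕ, ∃ S ∈ closedBall (0 : X →L[ℝ] Y) 1,
      ∀ x, ‖x‖ ≤ (d + 1 / ((N : ℝ) + 1)) * ‖S x‖ := by
    intro N
    have hlt : banachMazurDist X Y < ENNReal.ofReal (d + 1 / ((N : ℝ) + 1)) := by
      refine h.trans_lt ((ENNReal.ofReal_lt_ofReal_iff (by positivity)).2 ?_)
      have : 0 < 1 / ((N : ℝ) + 1) := by positivity
      linarith
    obtain ⟨T, hT⟩ := iInf_lt_iff.1 hlt
    rw [ENNReal.ofReal_lt_ofReal_iff (by positivity)] at hT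
    have hx : ∀ x, ‖x‖ ≤ ‖(T.symm : Y →L[ℝ] X)‖ * ‖T x‖ := fun x => by
      simpa using (T.symm : Y →L[ℝ] X).le_opNorm (T x)
    refine ⟨‖(T : X →L[ℝ] Y)‖⁻¹ • (T : X →L[ℝ] Y), ?_, fun x => ?_⟩
    · rw [mem_closedBall_zero_iff, norm_smul, norm_inv, norm_norm]
      exact inv_mul_le_one
    -- ‖T‖ = 0 occurs when X is trivial; the inverse is then 0 by convention and needs its own case.
    · rcases (norm_nonneg (T : X →L[ℝ] Y)).eq_or_lt with h0 | h0
      · have : T x = 0 := by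
          have := (T : X →L[ℝ] Y).le_opNorm x
          rw [← h0, zero_mul] at this
          exact norm_le_zero_iff.1 this
        have h1 := hx x
        rw [this, norm_zero, mul_zero] at h1
        exact h1.trans (by positivity)
      · have e : ‖(‖(T : X →L[ℝ] Y)‖⁻¹ • (T : X →L[ℝ] Y)) x‖ = ‖(T : X →L[ℝ] Y)‖⁻¹ * ‖T x‖ := by
          rw [smul_apply, norm_smul, norm_inv, norm_norm]
          rfl
        rw [e]
        calc ‖x‖ ≤ ‖(T.symm : Y →L[ℝ] X)‖ * ‖T x‖ := hx x
          _ = (‖(T : X →L[ℝ] Y)‖ * ‖(T.symm : Y →L[ℝ] X)‖) * (‖(T : X →L[ℝ] Y)‖⁻¹ * ‖T x‖) := by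
            field_simp
          _ ≤ _ := mul_le_mul_of_nonneg_right hT.le (by positivity)
  choose S hS hSd using hex
  have : ProperSpace (X →L[ℝ] Y) := FiniteDimensional.proper ℝ _
  obtain ⟨T, hT, φ, hφ, hlim⟩ := (isCompact_closedBall (0 : X →L[ℝ] Y) 1).tendsto_subseq hS
  refine ⟨T, fun x => ?_, fun x => ?_⟩
  · rw [mem_closedBall_zero_iff] at hT
    simpa using T.le_of_opNorm_le hT x
  · have h1 : Tendsto (fun N => S (φ N) x) atTop (𝓝 (T x)) :=
      ((ContinuousLinearMap.apply ℝ Y x).continuous.tendsto T).comp hlim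
    have h2 : Tendsto (fun N => d + 1 / (((φ N : ℕ) : ℝ) + 1)) atTop (𝓝 (d + 0)) :=
      (tendsto_one_div_add_atTop_nhds_zero_nat.comp hφ.tendsto_atTop).const_add d
    rw [add_zero] at h2
    exact ge_of_tendsto' (h2.mul h1.norm) fun N => hSd (φ N) x

end EquilateralDimension

theorem corollary1p11 (n : ℕ) (X : Submodule ℝ (Fin n → ℝ))
    (hX : Module.finrank ℝ X + 1 = n)
    (Y : Type*) [NormedAddCommGroup Y] [NormedSpace ℝ Y] [FiniteDimensional ℝ Y]
    (hY : Module.finrank ℝ Y + 1 = n)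
    (hXY : banachMazurDist X Y ≤ 2) :
    ((⌈(n : ℝ) / 2⌉₊ : ℕ) : ℕ∞) ≤ equilateralDim Y := by
  obtain ⟨T, hT, hT'⟩ := exists_linearMap_of_banachMazurDist_le (d := 2) (by norm_num)
    (by simpa using hXY)
  -- Here `hX` forces n ≥ 1, so truncated subtraction is harmless and k + 1 = ⌈n/2⌉.
  obtain ⟨L, hL⟩ := exists_linearIsometry_hyperplane (k := (n - 1) / 2) (by omega) X hX
  refine le_trans ?_ (le_equilateralDim_of_linearMap ((T : X →ₗ[ℝ] Y) ∘ₗ L)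
    (fun v => (hT (L v)).trans (hL v).le) fun v => (hL v).ge.trans (hT' (L v)))
  rw [Nat.cast_le, Nat.ceil_le, div_le_iff₀ two_pos]
  have : n ≤ ((n - 1) / 2 + 1) * 2 := by omega
  exact_mod_cast this
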